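/- Let $(\Omega,\mathcal F)$ be a measurable space and let $\mathcal L^\infty(\Omega,\mathcal F)$ be the space of all bounded $\mathcal F$-measurable functions $\Omega\to\mathbb R$ (with no identification of functions, and with the pointwise order). Let $M\subset\mathcal L^\infty(\Omega,\mathcal F)$ be a linear subspace with $1\in M$ that is closed under pointwise minima, $X\wedge Y\in M$ for all $X,Y\in M$, and let $\sigma(M)$ be the $\sigma$-algebra generated by $M$. A *pre-expectation* on a linear space $L\ni 1$ of bounded functions is a map $\mathcal E\colon L\to\mathbb R$ with $\mathcal E(X)\le\mathcal E(Y)$ whenever $X\le Y$, and $\mathcal E(\alpha)=\alpha$ for all constants $\alpha\in\mathbb R$; on $L=\mathcal L^\infty(\Omega,\sigma(M))$ it is called an *expectation*. It is *continuous from above* (*from below*) if $\mathcal E(X_n)\searrow\mathcal E(X)$ (resp. $\mathcal E(X_n)\nearrow\mathcal E(X)$) for all $X_n,X\in L$ with $X_n\searrow X$ (resp. $X_n\nearrow X$) pointwise. For a linear functional $\mu\colon L\to\mathbb R$ put $\mathcal E^*(\mu):=\sup_{X\in L}(\mu X-\mathcal E(X))\in(-\infty,\infty]$. A countably additive probability measure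 $\nu$ on $\sigma(M)$ is regarded as the linear functional $\nu X:=\int X\,d\nu$ on $\mathcal L^\infty(\Omega,\sigma(M))$, and $\nu|_M$ denotes its restriction to $M$. Let $\mathcal E\colon M\to\mathbb R$ be a convex pre-expectation that is continuous from above, and define, for $X\in\mathcal L^\infty(\Omega,\sigma(M))$, $$\bar{\mathcal E}(X):=\sup\Big\{\inf_{n\in\mathbb N}\mathcal E(X_n)\;:\;(X_n)_{n\in\mathbb N}\in M^{\mathbb N},\ X_n\ge X_{n+1}\ (n\in\mathbb N),\ X\ge\inf_{n\in\mathbb N}X_n\Big\}.$$ (Suprema and infima are taken in $[-\infty,\infty]$.) Let $\tilde{\mathcal E}\colon\mathcal L^\infty(\Omega,\sigma(M))\to\mathbb R$ be an expectation (not assumed convex) that is continuous from below and extends $\mathcal E$, i.e. $\tilde{\mathcal E}(X)=\mathcal E(X)$ for all $X\in M$. Then: (i) $\tilde{\mathcal E}(X)\le\bar{\mathcal E}(X)$ for all $X\in\mathcal L^\infty(\Omega,\sigma(M))$; (ii) $\tilde{\mathcal E}=\bar{\mathcal E}$ if and only if $\tilde{\mathcal E}^*(\nu)=\mathcal E^*(\nu|_M)$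 for all countably additive probability measures $\nu$ on $(\Omega,\sigma(M))$. -/

import Mathlib

open MeasureTheory Filter Topology

namespace NonlinearExpectation

variable {Ω : Type*}

/-- The space of all bounded functions `Ω → ℝ` that are measurable with respect to the
σ-algebra `m` (functions, not classes of almost everywhere equal functions). -/
def Linf (m : MeasurableSpace Ω) : Submodule ℝ (Ω → ℝ) where
  carrier := {X | Measurable[m] X ∧ ∃ C : ℝ, ∀ ω, |X ω| ≤ C}
  zero_mem' := ⟨measurable_const, 0, fun ω => by simp⟩
  add_mem' := by
    rintro X Y ⟨hX, C, hC⟩ ⟨hY, D, hD⟩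
    exact ⟨hX.add hY, C + D, fun ω => (abs_add_le _ _).trans (add_le_add (hC ω) (hD ω))⟩
  smul_mem' := by
    rintro a X ⟨hX, C, hC⟩
    refine ⟨hX.const_smul a, |a| * C, fun ω => ?_⟩
    simpa [abs_mul] using mul_le_mul_of_nonneg_left (hC ω) (abs_nonneg a)

/-- The σ-algebra generated by a set `M` of real functions: the smallest one for which all
members of `M` are (Borel) measurable. -/
@[reducible] def sigmaOf (M : Set (Ω → ℝ)) : MeasurableSpace Ω :=
  ⨆ X ∈ M, MeasurableSpace.comap X (borel ℝ)

/-- A linear subspace of bounded measurable functions consists of bounded functions that are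
measurable for the σ-algebra it generates. -/
theorem le_Linf_sigmaOf {m : MeasurableSpace Ω} {M : Submodule ℝ (Ω → ℝ)} (hM : M ≤ Linf m) :
    M ≤ Linf (sigmaOf (M : Set (Ω → ℝ))) := by
  intro X hX
  refine ⟨?_, (hM hX).2⟩
  rw [measurable_iff_comap_le, BorelSpace.measurable_eq (α := ℝ)]
  exact le_iSup₂_of_le (f := fun (X : Ω → ℝ) (_ : X ∈ (M : Set (Ω → ℝ))) =>
    MeasurableSpace.comap X (borel ℝ)) X hX le_rfl

/-- A (nonlinear) pre-expectation on a space `M` of functions that contains the constants: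
a monotone functional that preserves constants. When `M` is the space of all bounded
measurable functions it is called an expectation. -/
structure IsPreExpectation {M : Submodule ℝ (Ω → ℝ)} (E : M → ℝ) : Prop where
  mono : ∀ X Y : M, (∀ ω, (X : Ω → ℝ) ω ≤ (Y : Ω → ℝ) ω) → E X ≤ E Y
  const : ∀ (a : ℝ) (h : (fun _ : Ω => a) ∈ M), E ⟨fun _ => a, h⟩ = a

/-- `E` is continuous from above: `E (Xₙ) ↘ E X` whenever `Xₙ ↘ X` pointwise within `M`. -/
def ContinuousFromAbove {M : Submodule ℝ (Ω → ℝ)} (E : M → ℝ) : Prop :=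
  ∀ (Xs : ℕ → M) (X : M),
    (∀ ω, Antitone fun n => (Xs n : Ω → ℝ) ω) →
    (∀ ω, Tendsto (fun n => (Xs n : Ω → ℝ) ω) atTop (𝓝 ((X : Ω → ℝ) ω))) →
    Antitone (fun n => E (Xs n)) ∧ Tendsto (fun n => E (Xs n)) atTop (𝓝 (E X))

/-- `E` is continuous from below: `E (Xₙ) ↗ E X` whenever `Xₙ ↗ X` pointwise within `M`. -/
def ContinuousFromBelow {M : Submodule ℝ (Ω → ℝ)} (E : M → ℝ) : Prop :=
  ∀ (Xs : ℕ → M) (X : M),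
    (∀ ω, Monotone fun n => (Xs n : Ω → ℝ) ω) →
    (∀ ω, Tendsto (fun n => (Xs n : Ω → ℝ) ω) atTop (𝓝 ((X : Ω → ℝ) ω))) →
    Monotone (fun n => E (Xs n)) ∧ Tendsto (fun n => E (Xs n)) atTop (𝓝 (E X))

/-- The conjugate `E^*(μ) = sup_{X ∈ M} (μ X - E X)` of `E` at a linear functional `μ` on `M`,
with values in the extended reals. -/
noncomputable def conjugate {M : Submodule ℝ (Ω → ℝ)} (E : M → ℝ) (μ : M →ₗ[ℝ] ℝ) : EReal :=
  ⨆ X : M, ((μ X - E X : ℝ) : EReal)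

/-- The functional
`X ↦ sup { inf_n E(X_n) : X_n ∈ M, X_n ≥ X_{n+1}, X ≥ inf_n X_n }`.
Suprema and infima are taken in the extended reals, so that no convention about unbounded
sets of reals enters. -/
noncomputable def bar {M : Submodule ℝ (Ω → ℝ)} (E : M → ℝ) (X : Ω → ℝ) : EReal :=
  sSup {r : EReal | ∃ Xs : ℕ → M,
    (∀ n ω, (Xs (n + 1) : Ω → ℝ) ω ≤ (Xs n : Ω → ℝ) ω) ∧
    (∀ ω, ⨅ n, (((Xs n : Ω → ℝ) ω : ℝ) : EReal) ≤ ((X ω : ℝ) : EReal)) ∧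
    r = ⨅ n, ((E (Xs n) : ℝ) : EReal)}

theorem integrable_of_mem_Linf {m : MeasurableSpace Ω} (ν : ProbabilityMeasure Ω) {X : Ω → ℝ}
    (hX : X ∈ Linf m) : Integrable X (ν : Measure Ω) := by
  obtain ⟨hm, C, hC⟩ := hX
  exact Integrable.of_bound hm.aestronglyMeasurable C (Eventually.of_forall hC)

/-- A countably additive probability measure `ν` as the linear functional `X ↦ ∫ X dν` on the
bounded measurable functions. -/
noncomputable def integralFunctional {m : MeasurableSpace Ω} (ν : ProbabilityMeasure Ω) :
    Linf m →ₗ[ℝ] ℝ where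
  toFun X := ∫ ω, (X : Ω → ℝ) ω ∂(ν : Measure Ω)
  map_add' X Y := integral_add (integrable_of_mem_Linf ν X.2) (integrable_of_mem_Linf ν Y.2)
  map_smul' a _ := integral_const_mul a _

end NonlinearExpectation

/-! Part (i) is Choquet's capacitability theorem. Every bounded `σ(M)`-measurable `X` is a Suslin
function `sup_σ inf_n F σ n` over `M`. If `a < Et X`, continuity from below allows the coordinates
of `σ` to be bounded one after another, `σ i ≤ k i`, while every measurable majorant bounded by `C`,
a bound for `|X|`, keeps a value above `a`. The surviving `σ` form a compact set `K`. The maxima of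
`F σ n` over `K` are finite maxima, hence lie in `M`; they decrease, compactness puts their infimum
below `X`, and each has value above `a` (`exists_antitone_of_lt`).

For (ii), `E^* ≤ Et^*` holds because `Et` extends `E`. If `Et = bar E`, capacitability applied to
`ν` instead of `Et` replaces `X` by some `Xs n ∈ M` with almost the same `ν X - Et X`, so the
conjugates agree.

Conversely, let `Ys n ∈ M` decrease to a bounded `Y ≤ X`, and let `b = lim E (Ys n)`. Hahn–Banach
gives a linear minorant of the convex function `Z ↦ inf_n E (Z + Ys n) - b`. Continuity from above
makes it a Daniell integral, so it is a probability measure `ν`, and `E^*(ν) ≤ ν Y - b`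
(`exists_supporting_measure`). Then `ν Y - Et Y ≤ Et^*(ν) ≤ ν Y - b`, that is, `b ≤ Et Y ≤ Et X`. -/

namespace NonlinearExpectation

variable {Ω : Type*}

/-! ### Vector lattices with constants -/

/-- A vector lattice of real functions that contains the constants. -/
structure IsUnitalLattice (M : Submodule ℝ (Ω → ℝ)) : Prop where
  one_mem : (fun _ : Ω => (1 : ℝ)) ∈ M
  min_mem : ∀ X ∈ M, ∀ Y ∈ M, (fun ω => min (X ω) (Y ω)) ∈ M

namespace IsUnitalLattice

variable {M : Submodule ℝ (Ω → ℝ)} {X Y : Ω → ℝ}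

theorem const_mem (hL : IsUnitalLattice M) (a : ℝ) : (fun _ : Ω => a) ∈ M := by
  have := M.smul_mem a hL.one_mem
  convert this using 1
  ext; simp

theorem max_mem (hL : IsUnitalLattice M) (hX : X ∈ M) (hY : Y ∈ M) :
    (fun ω => max (X ω) (Y ω)) ∈ M := by
  have := M.neg_mem (hL.min_mem _ (M.neg_mem hX) _ (M.neg_mem hY))
  convert this using 1
  ext ω
  simp [min_neg_neg]

theorem affine_mem (hL : IsUnitalLattice M) (a b : ℝ) (hX : X ∈ M) :
    (fun ω => a * X ω + b) ∈ M :=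
  M.add_mem (M.smul_mem a hX) (hL.const_mem b)

theorem exists_isGreatest (hL : IsUnitalLattice M) {S : Set (Ω → ℝ)} (hS : S.Finite)
    (hne : S.Nonempty) (hSM : S ⊆ M) :
    ∃ Z ∈ M, ∀ ω, IsGreatest ((fun X : Ω → ℝ => X ω) '' S) (Z ω) := by
  have hne' : hS.toFinset.Nonempty := by simpa using hne
  refine ⟨hS.toFinset.sup' hne' id, ?_, fun ω => ⟨?_, ?_⟩⟩
  · exact Finset.sup'_induction hne' id (p := (· ∈ M)) (fun X hX Y hY => hL.max_mem hX hY)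
      fun X hX => hSM (by simpa using hX)
  · rw [Finset.sup'_apply]
    obtain ⟨X, hX, h⟩ := Finset.exists_mem_eq_sup' hne' fun X : Ω → ℝ => id X ω
    exact ⟨X, by simpa using hX, h.symm⟩
  · rintro _ ⟨X, hX, rfl⟩
    rw [Finset.sup'_apply]
    exact Finset.le_sup' (fun X : Ω → ℝ => id X ω) (by simpa using hX)

theorem inf_range_mem (hL : IsUnitalLattice M) (f : ℕ → Ω → ℝ) (hf : ∀ i, f i ∈ M)
    (n : ℕ) : (fun ω => (Finset.range (n + 1)).inf' Finset.nonempty_range_add_one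
      fun i => f i ω) ∈ M := by
  have : (Finset.range (n + 1)).inf' Finset.nonempty_range_add_one f ∈ M :=
    Finset.inf'_induction _ f (p := (· ∈ M)) (fun X hX Y hY => hL.min_mem X hX Y hY)
      fun i _ => hf i
  convert this using 1
  ext ω
  rw [Finset.inf'_apply]

end IsUnitalLattice

/-! ### Generators of `σ(M)` and Suslin functions over `M` -/

theorem sigmaOf_le {M : Set (Ω → ℝ)} {m : MeasurableSpace Ω}
    (h : ∀ X ∈ M, ∀ a : ℝ, MeasurableSet[m] {ω | a < X ω}) : sigmaOf M ≤ m := by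
  refine iSup₂_le fun X hX => ?_
  rw [← BorelSpace.measurable_eq (α := ℝ), ← measurable_iff_comap_le]
  exact measurable_of_Ioi (h X hX)

/-- The ramps `min (n (X - a)⁺) 1` increase to the indicator function of `{a < X}`. -/
theorem ramp_mem {M : Submodule ℝ (Ω → ℝ)} {X : Ω → ℝ} (hL : IsUnitalLattice M) (hX : X ∈ M)
    (a : ℝ) (n : ℕ) :
    (fun ω => min (n * max (X ω - a) 0) 1) ∈ M := by
  have h1 := hL.max_mem (hL.affine_mem 1 (-a) hX) (hL.const_mem 0)
  have h2 := hL.min_mem _ (hL.affine_mem n 0 h1) _ hL.one_mem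
  simpa [sub_eq_add_neg] using h2

theorem isLUB_ramp (X : Ω → ℝ) (a : ℝ) (ω : Ω) :
    IsLUB (Set.range fun n : ℕ => min (n * max (X ω - a) 0) 1)
      ({ω | a < X ω}.indicator 1 ω) := by
  by_cases h : a < X ω
  · rw [Set.indicator_of_mem (by exact h)]
    obtain ⟨n, hn⟩ := exists_nat_ge (1 / (X ω - a))
    rw [div_le_iff₀ (sub_pos.2 h)] at hn
    refine IsGreatest.isLUB ⟨⟨n, ?_⟩, ?_⟩
    · simp [max_eq_left (sub_pos.2 h).le, hn]
    · rintro _ ⟨n, rfl⟩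
      exact min_le_right _ _
  · rw [Set.indicator_of_notMem (by exact h)]
    have : max (X ω - a) 0 = 0 := max_eq_right (by linarith [not_lt.1 h])
    simp [this]

theorem isGLB_one_sub {f : ℕ → ℝ} {a : ℝ} (h : IsLUB (Set.range f) a) :
    IsGLB (Set.range fun n => 1 - f n) (1 - a) := by
  refine ⟨?_, fun b hb => ?_⟩
  · rintro _ ⟨n, rfl⟩
    linarith [h.1 ⟨n, rfl⟩]
  · have : a ≤ 1 - b := h.2 (by rintro _ ⟨n, rfl⟩; linarith [hb ⟨n, rfl⟩])
    linarith

theorem isLUB_indicator_iUnion (f : ℕ → Set Ω) (ω : Ω) :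
    IsLUB (Set.range fun n => (f n).indicator (1 : Ω → ℝ) ω)
      ((⋃ n, f n).indicator (1 : Ω → ℝ) ω) := by
  by_cases h : ω ∈ ⋃ n, f n
  · rw [Set.indicator_of_mem h]
    obtain ⟨n, hn⟩ := Set.mem_iUnion.1 h
    refine IsGreatest.isLUB ⟨⟨n, Set.indicator_of_mem hn _⟩, ?_⟩
    rintro _ ⟨n, rfl⟩
    exact Set.indicator_le_self' (by simp) ω
  · rw [Set.indicator_of_notMem h]
    have : ∀ n, (f n).indicator (1 : Ω → ℝ) ω = 0 := fun n =>
      Set.indicator_of_notMem (fun hn => h (Set.mem_iUnion.2 ⟨n, hn⟩)) _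
    simp [this]

/-- `X` is obtained from `M` by the Suslin operation: `X = sup_σ inf_n F σ n`, where `F σ n ∈ M`
is a locally constant function of `σ`. -/
def IsSuslin (M : Set (Ω → ℝ)) (X : Ω → ℝ) : Prop :=
  ∃ F : (ℕ → ℕ) → ℕ → Ω → ℝ, (∀ σ n, F σ n ∈ M) ∧ (∀ σ ω, Antitone fun n => F σ n ω) ∧
    (∀ n, IsLocallyConstant fun σ => F σ n) ∧
    (∀ ω r, r < X ω → ∃ σ, ∀ n, r ≤ F σ n ω) ∧
    ∀ σ ω r, (∀ n, r ≤ F σ n ω) → r ≤ X ω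

namespace IsSuslin

variable {M : Submodule ℝ (Ω → ℝ)} {X : Ω → ℝ}

theorem of_mem {M : Set (Ω → ℝ)} (hX : X ∈ M) : IsSuslin M X :=
  ⟨fun _ _ => X, fun _ _ => hX, fun _ _ => antitone_const, fun _ => .const _,
    fun _ _ h => ⟨0, fun _ => h.le⟩, fun _ _ _ h => h 0⟩

/-- The entry `σ 0` selects the index `i`; the shifted sequence is the code for `Xs i`. -/
theorem of_isLUB {M : Set (Ω → ℝ)} {Xs : ℕ → Ω → ℝ} (h : ∀ i, IsSuslin M (Xs i))
    (hX : ∀ ω, IsLUB (Set.range fun i => Xs i ω) (X ω)) : IsSuslin M X := by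
  choose F hM hanti hdep hlt hle using h
  refine ⟨fun σ n => F (σ 0) (fun i => σ (i + 1)) n, fun _ _ => hM _ _ _,
    fun _ _ => hanti _ _ _, fun n => ?_, fun ω r hr => ?_, fun σ ω r h => ?_⟩
  · rw [IsLocallyConstant.iff_eventually_eq]
    intro σ
    have h0 : ∀ᶠ τ : ℕ → ℕ in 𝓝 σ, τ 0 = σ 0 := by
      have hc : Continuous fun τ : ℕ → ℕ => τ 0 := by fun_prop
      exact ((IsLocallyConstant.of_discrete id).comp_continuous hc).eventually_eq σ
    have hc : Continuous fun τ : ℕ → ℕ => fun i => τ (i + 1) := by fun_prop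
    have h1 := ((hdep (σ 0) n).comp_continuous hc).eventually_eq σ
    filter_upwards [h0, h1] with τ h0 h1
    rw [h0]
    exact h1
  · obtain ⟨_, ⟨i, rfl⟩, hi⟩ := (lt_isLUB_iff (hX ω)).1 hr
    obtain ⟨σ, hσ⟩ := hlt i ω r hi
    exact ⟨fun n => n.casesOn i σ, hσ⟩
  · exact (hle _ _ _ _ h).trans ((hX ω).1 ⟨_, rfl⟩)

/-- `Nat.pair` packs one code for each `Xs i` into a single `σ`. Level `n` is the minimum of the
first `n + 1` schemes at their level `n`, so only finitely many members of `M` enter. -/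
theorem of_isGLB (hL : IsUnitalLattice M) {Xs : ℕ → Ω → ℝ}
    (h : ∀ i, IsSuslin (M : Set (Ω → ℝ)) (Xs i))
    (hX : ∀ ω, IsGLB (Set.range fun i => Xs i ω) (X ω)) : IsSuslin (M : Set (Ω → ℝ)) X := by
  choose F hM hanti hdep hlt hle using h
  refine ⟨fun σ n ω => (Finset.range (n + 1)).inf' Finset.nonempty_range_add_one
      fun i => F i (fun m => σ (Nat.pair i m)) n ω,
    fun σ n => hL.inf_range_mem _ (fun i => hM _ _ _) n, fun σ ω m n hmn => ?_,
    fun n => ?_, fun ω r hr => ?_, fun σ ω r h => ?_⟩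
  · refine Finset.le_inf' _ _ fun i hi => ?_
    refine (Finset.inf'_le _ (b := i) ?_).trans (hanti i _ ω hmn)
    simp only [Finset.mem_range] at hi ⊢
    omega
  · rw [IsLocallyConstant.iff_eventually_eq]
    intro σ
    have h1 : ∀ i, ∀ᶠ τ : ℕ → ℕ in 𝓝 σ,
        F i (fun m => τ (Nat.pair i m)) n = F i (fun m => σ (Nat.pair i m)) n := fun i => by
      have hc : Continuous fun τ : ℕ → ℕ => fun m => τ (Nat.pair i m) := by fun_prop
      exact ((hdep i n).comp_continuous hc).eventually_eq σ
    filter_upwards [(Finset.range (n + 1)).eventually_all.2 fun i _ => h1 i] with τ hτ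
    ext ω
    exact Finset.inf'_congr _ rfl fun i hi => by rw [hτ i hi]
  · have h1 : ∀ i, r < Xs i ω := fun i => hr.trans_le ((hX ω).1 ⟨i, rfl⟩)
    choose σ hσ using fun i => hlt i ω r (h1 i)
    refine ⟨fun k => σ k.unpair.1 k.unpair.2, fun n => Finset.le_inf' _ _ fun i _ => ?_⟩
    simpa using hσ i n
  · refine (hX ω).2 ?_
    rintro _ ⟨i, rfl⟩
    refine hle i (fun m => σ (Nat.pair i m)) ω r fun n => ?_
    -- At level `max n i` the `i`-th scheme has already entered the minimum.
    refine (h (max n i)).trans ((Finset.inf'_le _ (b := i) ?_).trans (hanti i _ ω (le_max_left n i)))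
    simp

theorem affine (hL : IsUnitalLattice M) (h : IsSuslin (M : Set (Ω → ℝ)) X) {a : ℝ} (ha : 0 ≤ a)
    (b : ℝ) : IsSuslin (M : Set (Ω → ℝ)) fun ω => a * X ω + b := by
  rcases ha.eq_or_lt with rfl | ha
  · simpa using of_mem (hL.const_mem b)
  obtain ⟨F, hM, hanti, hdep, hlt, hle⟩ := h
  refine ⟨fun σ n ω => a * F σ n ω + b, fun σ n => hL.affine_mem a b (hM σ n),
    fun σ ω m n hmn => ?_, fun n => (hdep n).comp fun Y : Ω → ℝ => fun ω => a * Y ω + b,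
    fun ω r hr => ?_, fun σ ω r h => ?_⟩
  · have := hanti σ ω hmn
    dsimp only at this ⊢
    gcongr
  · obtain ⟨σ, hσ⟩ := hlt ω ((r - b) / a) (by rw [div_lt_iff₀ ha]; linarith)
    refine ⟨σ, fun n => ?_⟩
    have := hσ n
    rw [div_le_iff₀ ha] at this
    linarith
  · have := hle σ ω ((r - b) / a) fun n => by rw [div_le_iff₀ ha]; linarith [h n]
    rw [div_le_iff₀ ha] at this
    linarith

/-- Suslin functions need not be stable under `1 - ·`. The sets for which both the indicator and its
complement are Suslin do form a σ-algebra, and it contains the generators `{a < X}` by way of ramps.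
-/
theorem indicator (hL : IsUnitalLattice M) {A : Set Ω}
    (hA : MeasurableSet[sigmaOf (M : Set (Ω → ℝ))] A) :
    IsSuslin (M : Set (Ω → ℝ)) (A.indicator 1) := by
  let m : MeasurableSpace Ω :=
    { MeasurableSet' := fun A => IsSuslin (M : Set (Ω → ℝ)) (A.indicator 1) ∧
        IsSuslin (M : Set (Ω → ℝ)) fun ω => 1 - A.indicator 1 ω
      measurableSet_empty := ⟨by simpa using of_mem (hL.const_mem 0),
        by simpa using of_mem hL.one_mem⟩
      measurableSet_compl := fun A h => by
        have : (Aᶜ.indicator 1 : Ω → ℝ) = fun ω => 1 - A.indicator 1 ω := by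
          rw [Set.indicator_compl]; rfl
        refine ⟨this ▸ h.2, ?_⟩
        simpa [this] using h.1
      measurableSet_iUnion := fun f h =>
        ⟨of_isLUB (fun i => (h i).1) fun ω => isLUB_indicator_iUnion f ω,
          of_isGLB hL (fun i => (h i).2) fun ω => isGLB_one_sub (isLUB_indicator_iUnion f ω)⟩ }
  refine (sigmaOf_le (m := m) (fun X hX a => ?_) A hA).1
  refine ⟨of_isLUB (fun n => of_mem (ramp_mem hL hX a n)) fun ω => isLUB_ramp X a ω,
    of_isGLB hL (fun n => of_mem ?_) fun ω => isGLB_one_sub (isLUB_ramp X a ω)⟩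
  have := hL.affine_mem (-1) 1 (ramp_mem hL hX a n)
  rw [SetLike.mem_coe]
  convert this using 1
  ext ω
  ring

/-- Every bounded `σ(M)`-measurable function is a Suslin function over `M`. -/
theorem of_mem_Linf (hL : IsUnitalLattice M) (hX : X ∈ Linf (sigmaOf (M : Set (Ω → ℝ)))) :
    IsSuslin (M : Set (Ω → ℝ)) X := by
  obtain ⟨hm, C, hC⟩ := hX
  obtain ⟨e, he⟩ := exists_surjective_nat ℚ
  -- `X` is the supremum over rationals `q` of `(q + C)⁺ 1_{q < X} - C`; the positive part keeps the
  -- coefficient nonnegative, as `affine` requires.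
  refine of_isLUB (Xs := fun n ω => max (e n + C) 0 * {ω | (e n : ℝ) < X ω}.indicator 1 ω + -C)
    (fun n => affine hL (indicator hL (hm measurableSet_Ioi)) (le_max_right _ _) _)
    fun ω => ⟨?_, fun b hb => ?_⟩
  · rintro _ ⟨n, rfl⟩
    have := (abs_le.1 (hC ω)).1
    by_cases h : (e n : ℝ) < X ω
    · have h1 : max (e n + C) 0 ≤ X ω + C := max_le (by linarith) (by linarith)
      simp only [Set.indicator_of_mem (show ω ∈ {ω | (e n : ℝ) < X ω} from h), Pi.one_apply]
      linarith
    · simp only [Set.indicator_of_notMem (show ω ∉ {ω | (e n : ℝ) < X ω} from h)]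
      linarith
  · refine le_of_forall_rat_lt_imp_le fun q hq => ?_
    obtain ⟨n, rfl⟩ := he q
    have := hb ⟨n, rfl⟩
    simp only [Set.indicator_of_mem (show ω ∈ {ω | (e n : ℝ) < X ω} from hq), Pi.one_apply] at this
    linarith [le_max_left ((e n : ℝ) + C) 0]

end IsSuslin

/-! ### Choquet capacitability -/

/-- Continuity from below of the outer functional `inf {E Y : Y ≥ X}`, for functions `X` given
through sets of lower bounds. -/
theorem exists_lt_of_lowerBounds {m : MeasurableSpace Ω} {E : Linf m → ℝ}
    (hmono : ∀ X Y : Linf m, (∀ ω, (X : Ω → ℝ) ω ≤ (Y : Ω → ℝ) ω) → E X ≤ E Y)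
    (hbelow : ContinuousFromBelow E) (C a : ℝ) {D : ℕ → Ω → Set ℝ} (hD : Monotone D)
    (h : ∀ Y : Linf m, (∀ ω, |(Y : Ω → ℝ) ω| ≤ C) →
      (∀ ω, ∀ n, ∀ r ∈ D n ω, r ≤ (Y : Ω → ℝ) ω) → a < E Y) :
    ∃ n, ∀ Y : Linf m, (∀ ω, |(Y : Ω → ℝ) ω| ≤ C) →
      (∀ ω, ∀ r ∈ D n ω, r ≤ (Y : Ω → ℝ) ω) → a < E Y := by
  by_contra! hcon
  choose Y hC hdom hle using hcon
  have hbb : ∀ n ω, BddBelow (Set.range fun k => (Y (n + k) : Ω → ℝ) ω) := fun n ω =>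
    ⟨-C, by rintro _ ⟨k, rfl⟩; exact (abs_le.1 (hC _ ω)).1⟩
  have hZle : ∀ n k ω, ⨅ k, (Y (n + k) : Ω → ℝ) ω ≤ (Y (n + k) : Ω → ℝ) ω := fun n k ω =>
    ciInf_le (hbb n ω) k
  have hZC : ∀ n ω, |⨅ k, (Y (n + k) : Ω → ℝ) ω| ≤ C := fun n ω => abs_le.2
    ⟨le_ciInf fun k => (abs_le.1 (hC _ ω)).1, (hZle n 0 ω).trans (abs_le.1 (hC _ ω)).2⟩
  -- The tail infima of the counterexamples `Y n` increase, still dominate `D n` because `D` grows,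
  -- and have value at most `a`. Their limit `W` contradicts `h`.
  let Z : ℕ → Linf m := fun n => ⟨fun ω => ⨅ k, (Y (n + k) : Ω → ℝ) ω,
    Measurable.iInf fun k => (Y (n + k)).2.1, C, hZC n⟩
  have hZmono : ∀ ω, Monotone fun n => (Z n : Ω → ℝ) ω := fun ω => by
    refine monotone_nat_of_le_succ fun n => le_ciInf fun k => ?_
    have := hZle n (1 + k) ω
    rwa [← add_assoc] at this
  have hba : ∀ ω, BddAbove (Set.range fun n => (Z n : Ω → ℝ) ω) := fun ω =>
    ⟨C, by rintro _ ⟨n, rfl⟩; exact (abs_le.1 (hZC n ω)).2⟩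
  have hWC : ∀ ω, |⨆ n, (Z n : Ω → ℝ) ω| ≤ C := fun ω => abs_le.2
    ⟨(abs_le.1 (hZC 0 ω)).1.trans (le_ciSup (hba ω) 0), ciSup_le fun n => (abs_le.1 (hZC n ω)).2⟩
  let W : Linf m := ⟨fun ω => ⨆ n, (Z n : Ω → ℝ) ω, Measurable.iSup fun n => (Z n).2.1, C, hWC⟩
  have hlim := (hbelow Z W hZmono fun ω => tendsto_atTop_ciSup (hZmono ω) (hba ω)).2
  refine (h W hWC fun ω n r hr => ?_).not_ge (le_of_tendsto' hlim fun n => ?_)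
  · refine le_trans (le_ciInf fun k => ?_) (le_ciSup (hba ω) n)
    exact hdom (n + k) ω r (hD (Nat.le_add_right n k) ω hr)
  · exact (hmono _ _ fun ω => hZle n 0 ω).trans (hle _)

theorem isCompact_pi_Iic (k : ℕ → ℕ) : IsCompact {σ : ℕ → ℕ | ∀ i, σ i ≤ k i} := by
  have : {σ : ℕ → ℕ | ∀ i, σ i ≤ k i} = Set.univ.pi fun i => Set.Iic (k i) := by
    ext; simp [Pi.le_def]
  rw [this]
  exact isCompact_univ_pi fun i => (Set.finite_Iic _).isCompact

/-- In the Baire space, an open set containing the compact set `∏ {0, …, k i}` contains one of the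
larger sets that restrict only finitely many coordinates. -/
theorem exists_prefix_subset {U : Set (ℕ → ℕ)} (hU : IsOpen U) (k : ℕ → ℕ)
    (hk : {σ : ℕ → ℕ | ∀ i, σ i ≤ k i} ⊆ U) :
    ∃ N, {σ : ℕ → ℕ | ∀ i < N, σ i ≤ k i} ⊆ U := by
  have hK := isCompact_pi_Iic k
  have hcyl : ∀ τ ∈ {σ : ℕ → ℕ | ∀ i, σ i ≤ k i}, ∃ N, PiNat.cylinder τ N ⊆ U := fun τ hτ => by
    obtain ⟨_, ⟨x, n, rfl⟩, hx, hsub⟩ :=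
      (PiNat.isTopologicalBasis_cylinders fun _ => ℕ).exists_subset_of_mem_open (hk hτ) hU
    exact ⟨n, by rwa [PiNat.mem_cylinder_iff_eq.1 hx]⟩
  choose! N hN using hcyl
  obtain ⟨t, ht, hcov⟩ := hK.elim_nhds_subcover (fun τ => PiNat.cylinder τ (N τ)) fun τ _ =>
    (PiNat.isOpen_cylinder _ τ _).mem_nhds (PiNat.self_mem_cylinder _ _)
  refine ⟨t.sup N, fun σ hσ => ?_⟩
  -- Cutting `σ` down to `min (σ i) (k i)` lands in the compact set and leaves unchanged all
  -- coordinates that the finite subcover looks at.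
  obtain ⟨τ, hτ, hmem⟩ := Set.mem_iUnion₂.1
    (hcov (show (fun i => min (σ i) (k i)) ∈ {σ : ℕ → ℕ | ∀ i, σ i ≤ k i} from
      fun i => min_le_right _ _))
  refine hN τ (ht τ hτ) fun i hi => ?_
  refine Eq.trans ?_ (hmem i hi)
  exact (min_eq_left (hσ i (hi.trans_le (Finset.le_sup hτ)))).symm

/-- Choquet capacitability: a functional on the bounded `σ(M)`-measurable functions that is
continuous from below can be approximated from below along decreasing sequences in `M`. -/
theorem exists_antitone_of_lt {M : Submodule ℝ (Ω → ℝ)} (hL : IsUnitalLattice M)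
    (hM : M ≤ Linf (sigmaOf (M : Set (Ω → ℝ))))
    {E : Linf (sigmaOf (M : Set (Ω → ℝ))) → ℝ}
    (hmono : ∀ X Y : Linf (sigmaOf (M : Set (Ω → ℝ))),
      (∀ ω, (X : Ω → ℝ) ω ≤ (Y : Ω → ℝ) ω) → E X ≤ E Y)
    (hbelow : ContinuousFromBelow E) (X : Linf (sigmaOf (M : Set (Ω → ℝ)))) {a : ℝ}
    (ha : a < E X) :
    ∃ Xs : ℕ → M, (∀ ω, Antitone fun n => (Xs n : Ω → ℝ) ω) ∧
      (∀ ω r, (∀ n, r ≤ (Xs n : Ω → ℝ) ω) → r ≤ (X : Ω → ℝ) ω) ∧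
      ∀ n, a < E (Submodule.inclusion hM (Xs n)) := by
  obtain ⟨F, hFM, hanti, hdep, hlt, hle⟩ := IsSuslin.of_mem_Linf hL X.2
  obtain ⟨-, C, hC⟩ := X.2
  -- `D A` encodes the function `sup_{σ ∈ A} inf_n F σ n`, which may fail to be measurable; `Q A`
  -- therefore speaks of its measurable majorants.
  let D : Set (ℕ → ℕ) → Ω → Set ℝ := fun A ω => {r | ∃ σ ∈ A, ∀ n, r ≤ F σ n ω}
  let Q : Set (ℕ → ℕ) → Prop := fun A => ∀ Y : Linf (sigmaOf (M : Set (Ω → ℝ))),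
    (∀ ω, |(Y : Ω → ℝ) ω| ≤ C) → (∀ ω, ∀ r ∈ D A ω, r ≤ (Y : Ω → ℝ) ω) → a < E Y
  have hstep : ∀ n A, ∃ k, Q A → Q (A ∩ {σ | σ n ≤ k}) := fun n A => by
    by_cases hA : Q A
    · have hD : Monotone fun k => D (A ∩ {σ | σ n ≤ k}) := fun k l hkl ω r ⟨σ, hσ, h⟩ =>
        ⟨σ, ⟨hσ.1, le_trans hσ.2 hkl⟩, h⟩
      obtain ⟨k, hk⟩ := exists_lt_of_lowerBounds hmono hbelow C a hD fun Y hY hdom =>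
        hA Y hY fun ω r ⟨σ, hσ, h⟩ => hdom ω (σ n) r ⟨σ, ⟨hσ, le_refl (σ n)⟩, h⟩
      exact ⟨k, fun _ => hk⟩
    · exact ⟨0, fun h => absurd h hA⟩
  choose f hf using hstep
  let B : ℕ → Set (ℕ → ℕ) := fun n => n.rec Set.univ fun n A => A ∩ {σ | σ n ≤ f n A}
  let k : ℕ → ℕ := fun n => f n (B n)
  have hB : ∀ n, B n = {σ | ∀ i < n, σ i ≤ k i} := fun n => by
    induction n with
    | zero => simp [B]
    | succ n ih =>
      have : B (n + 1) = B n ∩ {σ | σ n ≤ k n} := rfl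
      rw [this, ih]
      ext σ
      simp only [Set.mem_inter_iff, Set.mem_ofPred_eq]
      exact Nat.forall_lt_succ_right.symm
  have hQ : ∀ n, Q (B n) := fun n => by
    induction n with
    | zero =>
      refine fun Y _ hdom => ha.trans_le (hmono _ _ fun ω => le_of_forall_lt fun r hr => ?_)
      obtain ⟨s, hrs, hs⟩ := exists_between hr
      obtain ⟨σ, hσ⟩ := hlt ω s hs
      exact hrs.trans_le (hdom ω s ⟨σ, trivial, hσ⟩)
    | succ n ih => exact hf n (B n) ih
  have hK := isCompact_pi_Iic k
  set K := {σ : ℕ → ℕ | ∀ i, σ i ≤ k i} with hKdef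
  have hKne : K.Nonempty := ⟨0, fun i => Nat.zero_le _⟩
  have hfin : ∀ n, ((fun σ => F σ n) '' K).Finite := fun n => by
    have := isCompact_iff_compactSpace.1 hK
    have h1 := ((hdep n).comp_continuous (continuous_subtype_val (p := (· ∈ K)))).range_finite
    rwa [Set.range_comp, Subtype.range_coe] at h1
  choose Z hZM hZ using fun n => hL.exists_isGreatest (hfin n) (hKne.image _)
    (by rintro _ ⟨σ, _, rfl⟩; exact hFM σ n)
  have hZge : ∀ n ω, ∀ σ ∈ K, F σ n ω ≤ Z n ω := fun n ω σ hσ =>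
    (hZ n ω).2 ⟨_, ⟨σ, hσ, rfl⟩, rfl⟩
  have hZex : ∀ n ω, ∃ σ ∈ K, F σ n ω = Z n ω := fun n ω => by
    obtain ⟨_, ⟨σ, hσ, rfl⟩, h⟩ := (hZ n ω).1
    exact ⟨σ, hσ, h⟩
  -- The truncation at `-C` is harmless since `X ≥ -C`; it provides the lower bound that `Q` demands
  -- of its majorants.
  refine ⟨fun n => ⟨_, hL.max_mem (hZM n) (hL.const_mem (-C))⟩, fun ω m n hmn => ?_,
    fun ω r hr => ?_, fun n => ?_⟩
  · refine max_le_max ?_ le_rfl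
    obtain ⟨σ, hσ, h⟩ := hZex n ω
    rw [← h]
    exact (hanti σ ω hmn).trans (hZge m ω σ hσ)
  · rcases le_or_gt r (-C) with hrC | hrC
    · exact hrC.trans (abs_le.1 (hC ω)).1
    have hr' : ∀ n, r ≤ Z n ω := fun n => (le_max_iff.1 (hr n)).resolve_right hrC.not_ge
    have hclosed : ∀ n, IsClosed {σ | r ≤ F σ n ω} := fun n =>
      ⟨hdep n {Y | r ≤ Y ω}ᶜ⟩
    -- For each `n` some `σ ∈ K` has `r ≤ F σ n ω`. These closed subsets of `K` are nested, so one
    -- `σ` serves all `n`.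
    obtain ⟨σ, hσ⟩ := IsCompact.nonempty_iInter_of_sequence_nonempty_isCompact_isClosed
      (fun n => K ∩ {σ | r ≤ F σ n ω})
      (fun n σ hσ => ⟨hσ.1, le_trans hσ.2 (hanti σ ω n.le_succ)⟩)
      (fun n => by
        obtain ⟨σ, hσ, h⟩ := hZex n ω
        exact ⟨σ, hσ, (hr' n).trans h.ge⟩)
      (hK.inter_right (hclosed 0)) (fun n => hK.isClosed.inter (hclosed n))
    exact hle σ ω r fun n => (Set.mem_iInter.1 hσ n).2
  -- By local constancy, bounding finitely many coordinates already forces `F σ n` to be one of the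
  -- values taken on `K`. So `Z n` dominates the function encoded by `D (B N)`, and `Q (B N)`
  -- applies.
  · obtain ⟨N, hN⟩ := exists_prefix_subset
      (U := (fun σ => F σ n) ⁻¹' ((fun σ => F σ n) '' K)) (hdep n _) k
      (Set.subset_preimage_image _ _)
    rw [← hB] at hN
    have hW := hM (hL.max_mem (hZM n) (hL.const_mem (-C)))
    have hYC : ∀ ω, |min (max (Z n ω) (-C)) C| ≤ C := fun ω => by
      have : 0 ≤ C := (abs_nonneg _).trans (hC ω)
      exact abs_le.2 ⟨le_min (le_max_right _ _) (by linarith), min_le_right _ _⟩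
    refine (hQ N ⟨fun ω => min (max (Z n ω) (-C)) C, hW.1.min measurable_const, C, hYC⟩ hYC
      fun ω r ⟨σ, hσ, h⟩ => ?_).trans_le (hmono _ _ fun ω => min_le_left _ _)
    obtain ⟨τ, hτ, hτσ⟩ := hN hσ
    refine le_min (le_max_of_le_left ((h n).trans ?_))
      ((hle σ ω r h).trans (abs_le.1 (hC ω)).2)
    have : F τ n ω = F σ n ω := congrFun hτσ ω
    rw [← this]
    exact hZge n ω τ hτ

theorem le_bar {M : Submodule ℝ (Ω → ℝ)} (hL : IsUnitalLattice M)
    (hM : M ≤ Linf (sigmaOf (M : Set (Ω → ℝ))))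
    {Et : Linf (sigmaOf (M : Set (Ω → ℝ))) → ℝ} {E : M → ℝ}
    (hmono : ∀ X Y : Linf (sigmaOf (M : Set (Ω → ℝ))),
      (∀ ω, (X : Ω → ℝ) ω ≤ (Y : Ω → ℝ) ω) → Et X ≤ Et Y)
    (hbelow : ContinuousFromBelow Et) (hext : ∀ X : M, Et (Submodule.inclusion hM X) = E X)
    (X : Linf (sigmaOf (M : Set (Ω → ℝ)))) : (Et X : EReal) ≤ bar E X := by
  refine EReal.ge_of_forall_gt_iff_ge.1 fun a ha => ?_
  obtain ⟨Xs, hanti, hle, hlt⟩ :=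
    exists_antitone_of_lt hL hM hmono hbelow X (EReal.coe_lt_coe_iff.1 ha)
  refine le_trans (le_iInf fun n => ?_)
    (le_sSup ⟨Xs, fun n ω => hanti ω n.le_succ, fun ω => ?_, rfl⟩)
  · rw [← hext]
    exact EReal.coe_le_coe_iff.2 (hlt n).le
  · refine EReal.ge_of_forall_gt_iff_ge.1 fun r hr => ?_
    exact EReal.coe_le_coe_iff.2 (hle ω r fun n =>
      EReal.coe_le_coe_iff.1 (hr.le.trans (iInf_le _ n)))

/-! ### The Daniell–Stone theorem -/

/-- `f` is an increasing sequence of nonnegative members of `M` whose supremum is at least `1`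
on `A`. -/
structure IsCover (M : Set (Ω → ℝ)) (A : Set Ω) (f : ℕ → Ω → ℝ) : Prop where
  mem : ∀ n, f n ∈ M
  nonneg : ∀ n ω, 0 ≤ f n ω
  mono : ∀ ω, Monotone fun n => f n ω
  exists_lt : ∀ ω ∈ A, ∀ r < 1, ∃ n, r < f n ω

/-- The Daniell outer measure of a set. -/
noncomputable def daniellOuter (M : Set (Ω → ℝ)) (φ : (Ω → ℝ) → ℝ) (A : Set Ω) : ENNReal :=
  ⨅ (f : ℕ → Ω → ℝ) (_ : IsCover M A f), ⨆ n, ENNReal.ofReal (φ (f n))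

/-- The integrals in the sense of Daniell on a vector lattice `M` containing the constants, given
as linear functionals on all functions that behave well on `M`. -/
structure IsDaniell (M : Submodule ℝ (Ω → ℝ)) (φ : (Ω → ℝ) →ₗ[ℝ] ℝ) : Prop where
  lattice : IsUnitalLattice M
  nonneg : ∀ X ∈ M, (∀ ω, 0 ≤ X ω) → 0 ≤ φ X
  map_one : φ (fun _ => 1) = 1
  tendsto_zero : ∀ Z : ℕ → Ω → ℝ, (∀ n, Z n ∈ M) → (∀ ω, Antitone fun n => Z n ω) →
    (∀ ω, Tendsto (fun n => Z n ω) atTop (𝓝 0)) → Tendsto (fun n => φ (Z n)) atTop (𝓝 0)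

namespace IsDaniell

variable {M : Submodule ℝ (Ω → ℝ)} {φ : (Ω → ℝ) →ₗ[ℝ] ℝ}

theorem mono (h : IsDaniell M φ) {X Y : Ω → ℝ} (hX : X ∈ M) (hY : Y ∈ M) (hXY : ∀ ω, X ω ≤ Y ω) :
    φ X ≤ φ Y := by
  have := h.nonneg _ (M.sub_mem hY hX) fun ω => sub_nonneg.2 (hXY ω)
  rw [map_sub] at this
  linarith

theorem daniellOuter_le {A : Set Ω} {f : ℕ → Ω → ℝ} (hf : IsCover (M : Set (Ω → ℝ)) A f) :
    daniellOuter (M : Set (Ω → ℝ)) φ A ≤ ⨆ n, ENNReal.ofReal (φ (f n)) :=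
  iInf₂_le f hf

theorem daniellOuter_le_of_one_le {A : Set Ω} {g : Ω → ℝ} (hg : g ∈ M) (h0 : ∀ ω, 0 ≤ g ω)
    (h1 : ∀ ω ∈ A, 1 ≤ g ω) :
    daniellOuter (M : Set (Ω → ℝ)) φ A ≤ ENNReal.ofReal (φ g) := by
  refine (daniellOuter_le (f := fun _ => g) ⟨fun _ => hg, fun _ => h0, fun _ => monotone_const,
    fun ω hω r hr => ⟨0, hr.trans_le (h1 ω hω)⟩⟩).trans ?_
  simp

/-- For a cover `f` of the whole space `(1 - f n)⁺` decreases to `0`, so `φ (f n)` is eventually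
almost `1`. This is where the Daniell continuity of `φ` enters. -/
theorem one_le_daniellOuter_univ (h : IsDaniell M φ) :
    1 ≤ daniellOuter (M : Set (Ω → ℝ)) φ Set.univ := by
  refine le_iInf₂ fun f hf => ?_
  let Z : ℕ → Ω → ℝ := fun n ω => max (1 - f n ω) 0
  have hsub : ∀ n, (fun ω => 1 - f n ω) ∈ M := fun n => M.sub_mem h.lattice.one_mem (hf.mem n)
  have hZM : ∀ n, Z n ∈ M := fun n => h.lattice.max_mem (hsub n) (h.lattice.const_mem 0)
  have hZ := h.tendsto_zero Z hZM
    (fun ω m n hmn => max_le_max (sub_le_sub_left (hf.mono ω hmn) 1) le_rfl) fun ω => by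
      refine tendsto_order.2 ⟨fun a ha => Eventually.of_forall fun n =>
        ha.trans_le (le_max_right _ _), fun a ha => ?_⟩
      obtain ⟨N, hN⟩ := hf.exists_lt ω trivial (1 - a) (by linarith)
      filter_upwards [eventually_ge_atTop N] with n hn
      have : f N ω ≤ f n ω := hf.mono ω hn
      exact max_lt (by linarith) ha
  have key : ∀ n, 1 - φ (Z n) ≤ φ (f n) := fun n => by
    have h1 := h.mono (hsub n) (hZM n) fun ω => le_max_left _ _
    have h2 : φ (fun ω => 1 - f n ω) = φ (fun _ => 1) - φ (f n) := map_sub φ _ _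
    rw [h2, h.map_one] at h1
    linarith
  have hlim : Tendsto (fun n => ENNReal.ofReal (1 - φ (Z n))) atTop (𝓝 1) := by
    have := ENNReal.tendsto_ofReal (hZ.const_sub 1)
    simpa using this
  exact le_of_tendsto' hlim fun n => (ENNReal.ofReal_le_ofReal (key n)).trans
    (le_iSup (fun n => ENNReal.ofReal (φ (f n))) n)

/-- The outer measure induced by a Daniell integral. -/
noncomputable def outerMeasure (h : IsDaniell M φ) : OuterMeasure Ω where
  measureOf := daniellOuter (M : Set (Ω → ℝ)) φ
  empty := by
    have := daniellOuter_le_of_one_le (φ := φ) (A := ∅) M.zero_mem (fun _ => le_rfl)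
      fun _ h => absurd h (Set.notMem_empty _)
    simpa using this
  mono := fun {s t} hst => le_iInf₂ fun f hf =>
    daniellOuter_le ⟨hf.mem, hf.nonneg, hf.mono, fun ω hω => hf.exists_lt ω (hst hω)⟩
  iUnion_nat := fun s _ => by
    refine ENNReal.le_of_forall_pos_le_add fun ε hε hlt => ?_
    obtain ⟨δ, hδ, hsum⟩ := ENNReal.exists_pos_sum_of_countable' (by simpa using hε.ne' :
      (ε : ENNReal) ≠ 0) ℕ
    have hex : ∀ i, ∃ f, IsCover (M : Set (Ω → ℝ)) (s i) f ∧
        ⨆ n, ENNReal.ofReal (φ (f n)) ≤ daniellOuter (M : Set (Ω → ℝ)) φ (s i) + δ i := fun i => by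
      have hfin : daniellOuter (M : Set (Ω → ℝ)) φ (s i) ≠ ⊤ :=
        ((ENNReal.le_tsum i).trans_lt hlt).ne
      have := ENNReal.lt_add_right hfin (hδ i).ne'
      obtain ⟨f, hf⟩ := iInf_lt_iff.1 this
      obtain ⟨hf, h⟩ := iInf_lt_iff.1 hf
      exact ⟨f, hf, h.le⟩
    choose f hf hle using hex
    -- The diagonal sums stay in `M` and increase because every `f i` is nonnegative and increasing.
    have hcov : IsCover (M : Set (Ω → ℝ)) (⋃ i, s i) fun n => ∑ i ∈ Finset.range n, f i n := by
      refine ⟨fun n => M.sum_mem fun i _ => (hf i).mem n, fun n ω => ?_, fun ω => ?_,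
        fun ω hω r hr => ?_⟩
      · rw [Finset.sum_apply]
        exact Finset.sum_nonneg fun i _ => (hf i).nonneg n ω
      · intro m n hmn
        simp only [Finset.sum_apply]
        exact (Finset.sum_le_sum fun i _ => (hf i).mono ω hmn).trans
          (Finset.sum_le_sum_of_subset_of_nonneg (Finset.range_mono hmn)
            fun i _ _ => (hf i).nonneg n ω)
      · obtain ⟨i, hi⟩ := Set.mem_iUnion.1 hω
        obtain ⟨N, hN⟩ := (hf i).exists_lt ω hi r hr
        refine ⟨max N (i + 1), hN.trans_le (((hf i).mono ω (le_max_left N (i + 1))).trans ?_)⟩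
        rw [Finset.sum_apply]
        exact Finset.single_le_sum (f := fun j => f j (max N (i + 1)) ω)
          (fun j _ => (hf j).nonneg _ ω) (by simp)
    refine (daniellOuter_le hcov).trans (iSup_le fun n => ?_)
    rw [map_sum, ENNReal.ofReal_sum_of_nonneg fun i _ => h.nonneg _ ((hf i).mem n) ((hf i).nonneg n)]
    calc ∑ i ∈ Finset.range n, ENNReal.ofReal (φ (f i n))
        ≤ ∑ i ∈ Finset.range n, (daniellOuter (M : Set (Ω → ℝ)) φ (s i) + δ i) :=
          Finset.sum_le_sum fun i _ =>
            (le_iSup (fun n => ENNReal.ofReal (φ (f i n))) n).trans (hle i)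
      _ ≤ ∑' i, (daniellOuter (M : Set (Ω → ℝ)) φ (s i) + δ i) := ENNReal.sum_le_tsum _
      _ = ∑' i, daniellOuter (M : Set (Ω → ℝ)) φ (s i) + ∑' i, δ i := ENNReal.tsum_add
      _ ≤ _ := by gcongr

theorem outerMeasure_apply (h : IsDaniell M φ) (A : Set Ω) :
    h.outerMeasure A = daniellOuter (M : Set (Ω → ℝ)) φ A := rfl

/-- With ramps `g k` increasing to the indicator of `{a < X}`, a cover `f` of `T` splits into `f ∧ g
k` and `f - f ∧ g k`. The diagonal of the former covers the part inside; the latter, for each fixed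
`k`, covers the part outside, where `g k` vanishes. -/
theorem sigmaOf_le_caratheodory (h : IsDaniell M φ) :
    sigmaOf (M : Set (Ω → ℝ)) ≤ h.outerMeasure.caratheodory := by
  refine sigmaOf_le fun X hX a => (OuterMeasure.isCaratheodory_iff_le' _).2 fun T => ?_
  simp only [outerMeasure_apply]
  refine le_iInf₂ fun f hf => ?_
  let g : ℕ → Ω → ℝ := fun n ω => min (n * max (X ω - a) 0) 1
  have hgM : ∀ n, g n ∈ M := ramp_mem h.lattice hX a
  have hg0 : ∀ n ω, 0 ≤ g n ω := fun n ω => le_min (by positivity) zero_le_one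
  have hgmono : ∀ ω, Monotone fun n => g n ω := fun ω m n hmn => by
    dsimp only [g]
    gcongr
  let u : ℕ → ℕ → Ω → ℝ := fun k n ω => min (f n ω) (g k ω)
  have huM : ∀ k n, u k n ∈ M := fun k n => h.lattice.min_mem _ (hf.mem n) _ (hgM k)
  have hu0 : ∀ k n ω, 0 ≤ u k n ω := fun k n ω => le_min (hf.nonneg n ω) (hg0 k ω)
  have hin : IsCover (M : Set (Ω → ℝ)) (T ∩ {ω | a < X ω}) fun n => u n n := by
    refine ⟨fun n => huM n n, fun n => hu0 n n,
      fun ω m n hmn => min_le_min (hf.mono ω hmn) (hgmono ω hmn), fun ω hω r hr => ?_⟩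
    obtain ⟨N, hN⟩ := hf.exists_lt ω hω.1 r hr
    have hlub := isLUB_ramp X a ω
    rw [Set.indicator_of_mem hω.2] at hlub
    obtain ⟨_, ⟨k, rfl⟩, hk⟩ := (lt_isLUB_iff hlub).1 hr
    exact ⟨max N k, lt_min (hN.trans_le (hf.mono ω (le_max_left N k)))
      (hk.trans_le (hgmono ω (le_max_right N k)))⟩
  have hout : ∀ k, IsCover (M : Set (Ω → ℝ)) (T \ {ω | a < X ω}) fun n => f n - u k n := by
    intro k
    refine ⟨fun n => M.sub_mem (hf.mem n) (huM k n), fun n ω => sub_nonneg.2 (min_le_left _ _),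
      fun ω m n hmn => ?_, fun ω hω r hr => ?_⟩
    · have := hf.mono ω hmn
      simp only [Pi.sub_apply, u] at this ⊢
      rcases min_cases (f m ω) (g k ω) with h1 | h1 <;>
        rcases min_cases (f n ω) (g k ω) with h2 | h2 <;> linarith
    · obtain ⟨N, hN⟩ := hf.exists_lt ω hω.1 r hr
      have h0 : g k ω = 0 := by
        have : max (X ω - a) 0 = 0 := max_eq_right (sub_nonpos.2 (not_lt.1 hω.2))
        simp [g, this]
      refine ⟨N, ?_⟩
      simpa [u, h0, min_eq_right (hf.nonneg N ω)] using hN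
  refine (add_le_add (daniellOuter_le hin) le_rfl).trans ?_
  rw [ENNReal.iSup_add]
  refine iSup_le fun k => (add_le_add le_rfl (daniellOuter_le (hout k))).trans ?_
  rw [ENNReal.add_iSup]
  refine iSup_le fun n => le_trans ?_
    (le_iSup (fun n => ENNReal.ofReal (φ (f n))) (max k n))
  -- Raising both indices to `max k n` with the ramp `g k` fixed makes the two pieces add up to `f
  -- (max k n)`.
  have h1 := h.mono (huM k k) (huM k (max k n)) fun ω =>
    min_le_min (hf.mono ω (le_max_left k n)) le_rfl
  have h2 := h.mono ((hout k).mem n) ((hout k).mem (max k n)) fun ω =>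
    (hout k).mono ω (le_max_right k n)
  rw [← ENNReal.ofReal_add (h.nonneg _ (huM k k) (hu0 k k))
    (h.nonneg _ ((hout k).mem n) ((hout k).nonneg n))]
  refine ENNReal.ofReal_le_ofReal ?_
  rw [map_sub φ (f (max k n))] at h2
  linarith

/-- The measure induced by a Daniell integral. -/
noncomputable def measure (h : IsDaniell M φ) : @Measure Ω (sigmaOf (M : Set (Ω → ℝ))) :=
  @OuterMeasure.toMeasure Ω (sigmaOf (M : Set (Ω → ℝ))) h.outerMeasure h.sigmaOf_le_caratheodory

theorem measure_apply (h : IsDaniell M φ) {A : Set Ω}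
    (hA : MeasurableSet[sigmaOf (M : Set (Ω → ℝ))] A) :
    h.measure A = daniellOuter (M : Set (Ω → ℝ)) φ A :=
  @toMeasure_apply Ω (sigmaOf (M : Set (Ω → ℝ))) _ h.sigmaOf_le_caratheodory A hA

instance isProbabilityMeasure_measure (h : IsDaniell M φ) : IsProbabilityMeasure h.measure := by
  refine ⟨?_⟩
  rw [h.measure_apply (@MeasurableSet.univ _ (sigmaOf (M : Set (Ω → ℝ))))]
  refine le_antisymm ?_ h.one_le_daniellOuter_univ
  simpa [h.map_one] using daniellOuter_le_of_one_le (φ := φ) (A := Set.univ) h.lattice.one_mem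
    (fun _ => zero_le_one) fun _ _ => le_rfl

end IsDaniell

namespace IsDaniell

variable {M : Submodule ℝ (Ω → ℝ)} {φ : (Ω → ℝ) →ₗ[ℝ] ℝ}

theorem integrable (h : IsDaniell M φ) (hM : M ≤ Linf (sigmaOf (M : Set (Ω → ℝ))))
    {X : Ω → ℝ} (hX : X ∈ M) : Integrable X h.measure :=
  integrable_of_mem_Linf ⟨h.measure, h.isProbabilityMeasure_measure⟩ (hM hX)

/-- Cut `N X` into horizontal slices `f j` with `1_{A (j + 1)} ≤ f j ≤ 1_{A j}`. A slice is itself a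
cover of `A (j + 1)`, so `∫ f j - φ (f j)` is at most the measure of `A j` minus that of `A (j +
1)`, and the sum telescopes. -/
theorem mul_integral_sub_le (h : IsDaniell M φ) (hM : M ≤ Linf (sigmaOf (M : Set (Ω → ℝ))))
    {X : Ω → ℝ} (hX : X ∈ M) (h0 : ∀ ω, 0 ≤ X ω) (h1 : ∀ ω, X ω ≤ 1) {N : ℕ} (hN : 0 < N) :
    N * (∫ ω, X ω ∂h.measure - φ X) ≤ 1 := by
  have hN' : (0 : ℝ) < N := Nat.cast_pos.2 hN
  let c : ℕ → ℝ := fun j => j / N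
  have hc : ∀ j, c (j + 1) = c j + 1 / N := fun j => by simp only [c]; push_cast; ring
  have hpos : (0 : ℝ) < 1 / N := by positivity
  let f : ℕ → Ω → ℝ := fun j => (N : ℝ) • ((fun ω => min (X ω) (c (j + 1))) - fun ω => min (X ω) (c j))
  have hfω : ∀ j ω, f j ω = N * (min (X ω) (c (j + 1)) - min (X ω) (c j)) := fun j ω => rfl
  have hmin : ∀ j, (fun ω => min (X ω) (c j)) ∈ M := fun j =>
    h.lattice.min_mem _ hX _ (h.lattice.const_mem _)
  have hfM : ∀ j, f j ∈ M := fun j => M.smul_mem _ (M.sub_mem (hmin _) (hmin _))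
  have hf0 : ∀ j ω, 0 ≤ f j ω := fun j ω => by
    rw [hfω]
    refine mul_nonneg hN'.le (sub_nonneg.2 (min_le_min le_rfl ?_))
    linarith [hc j]
  have hf1 : ∀ j ω, f j ω ≤ 1 := fun j ω => by
    rw [hfω, ← le_div_iff₀' hN']
    rcases min_cases (X ω) (c (j + 1)) with h1 | h1 <;>
      rcases min_cases (X ω) (c j) with h2 | h2 <;> linarith [hc j]
  let A : ℕ → Set Ω := fun j => {ω | c j < X ω}
  have hA : ∀ j, MeasurableSet[sigmaOf (M : Set (Ω → ℝ))] (A j) := fun j =>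
    (hM hX).1 measurableSet_Ioi
  let a : ℕ → ℝ := fun j => h.measure.real (A j)
  have hφ : ∀ j, a (j + 1) ≤ φ (f j) := fun j => by
    refine ENNReal.toReal_le_of_le_ofReal (h.nonneg _ (hfM j) (hf0 j)) ?_
    rw [h.measure_apply (hA _)]
    refine daniellOuter_le_of_one_le (hfM j) (hf0 j) fun ω hω => ?_
    have hω : c (j + 1) < X ω := hω
    rw [hfω, min_eq_right hω.le, min_eq_right (by linarith [hc j]), hc]
    field_simp
    simp
  have hint : ∀ j, ∫ ω, f j ω ∂h.measure ≤ a j := fun j => by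
    simp only [a]
    rw [← @integral_indicator_one Ω (sigmaOf (M : Set (Ω → ℝ))) h.measure (A j) (hA j)]
    refine integral_mono (h.integrable hM (hfM j))
      ((integrable_const (1 : ℝ)).indicator (hA j)) fun ω => ?_
    by_cases hω : c j < X ω
    · rw [Set.indicator_of_mem (show ω ∈ A j from hω)]
      exact hf1 j ω
    · rw [Set.indicator_of_notMem (show ω ∉ A j from hω), hfω, min_eq_left (not_lt.1 hω),
        min_eq_left (by linarith [hc j, not_lt.1 hω])]
      simp
  have hsum : ∑ j ∈ Finset.range N, f j = (N : ℝ) • X := by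
    ext ω
    simp only [Finset.sum_apply, hfω, Pi.smul_apply, smul_eq_mul]
    rw [← Finset.mul_sum, Finset.sum_range_sub fun j => min (X ω) (c j)]
    simp [c, hN'.ne', h0 ω, h1 ω]
  have hφsum : ∑ j ∈ Finset.range N, φ (f j) = N * φ X := by
    rw [← map_sum, hsum, map_smul, smul_eq_mul]
  have hintsum : ∑ j ∈ Finset.range N, ∫ ω, f j ω ∂h.measure = N * ∫ ω, X ω ∂h.measure := by
    rw [← integral_finsetSum _ fun j _ => h.integrable hM (hfM j), ← integral_const_mul]
    congr 1
    ext ω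
    simpa using congrFun hsum ω
  calc N * (∫ ω, X ω ∂h.measure - φ X)
      = ∑ j ∈ Finset.range N, (∫ ω, f j ω ∂h.measure - φ (f j)) := by
        rw [Finset.sum_sub_distrib, hφsum, hintsum]; ring
    _ ≤ ∑ j ∈ Finset.range N, (a j - a (j + 1)) :=
        Finset.sum_le_sum fun j _ => sub_le_sub (hint j) (hφ j)
    _ = a 0 - a N := Finset.sum_range_sub' a N
    _ ≤ 1 := by
        have h2 : a 0 ≤ 1 := measureReal_le_one
        have h3 : 0 ≤ a N := measureReal_nonneg
        linarith

theorem integral_le_of_mem_Icc (h : IsDaniell M φ) (hM : M ≤ Linf (sigmaOf (M : Set (Ω → ℝ))))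
    {X : Ω → ℝ} (hX : X ∈ M) (h0 : ∀ ω, 0 ≤ X ω) (h1 : ∀ ω, X ω ≤ 1) :
    ∫ ω, X ω ∂h.measure ≤ φ X := by
  by_contra! hlt
  obtain ⟨N, hN⟩ := exists_nat_gt (1 / (∫ ω, X ω ∂h.measure - φ X))
  have hpos := sub_pos.2 hlt
  have hN0 : (0 : ℝ) < N := (one_div_pos.2 hpos).trans hN
  rw [div_lt_iff₀ hpos] at hN
  linarith [h.mul_integral_sub_le hM hX h0 h1 (Nat.cast_pos.1 hN0)]

/-- Daniell–Stone: a Daniell integral is the integral with respect to the measure it induces. -/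
theorem integral_eq (h : IsDaniell M φ) (hM : M ≤ Linf (sigmaOf (M : Set (Ω → ℝ))))
    {X : Ω → ℝ} (hX : X ∈ M) : ∫ ω, X ω ∂h.measure = φ X := by
  -- One inequality suffices, as it also applies to `-X`. An affine change maps `X` into `[0, 1]`;
  -- the `+ 1` in `D` keeps the divisor positive.
  have key : ∀ X ∈ M, ∫ ω, X ω ∂h.measure ≤ φ X := fun X hX => by
    obtain ⟨C, hC⟩ := (hM hX).2
    let D : ℝ := |C| + 1
    have hD : 0 < D := by positivity
    have hXD : ∀ ω, -D ≤ X ω ∧ X ω ≤ D := fun ω =>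
      abs_le.1 ((hC ω).trans ((le_abs_self C).trans (le_add_of_nonneg_right zero_le_one)))
    have h2D : (0 : ℝ) < 2 * D := by positivity
    have hle := h.integral_le_of_mem_Icc hM (h.lattice.affine_mem (1 / (2 * D)) (1 / 2) hX)
      (fun ω => by
        have : -(1 / 2) ≤ 1 / (2 * D) * X ω := by
          rw [one_div_mul_eq_div, le_div_iff₀ h2D]; linarith [(hXD ω).1]
        linarith)
      (fun ω => by
        have : 1 / (2 * D) * X ω ≤ 1 / 2 := by
          rw [one_div_mul_eq_div, div_le_iff₀ h2D]; linarith [(hXD ω).2]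
        linarith)
    have hφ : φ (fun ω => 1 / (2 * D) * X ω + 1 / 2) = 1 / (2 * D) * φ X + 1 / 2 := by
      have : (fun ω => 1 / (2 * D) * X ω + 1 / 2) =
          (1 / (2 * D)) • X + (1 / 2 : ℝ) • fun _ => (1 : ℝ) := by ext ω; simp
      rw [this, map_add, map_smul, map_smul, h.map_one]
      simp
    rw [hφ, integral_add ((h.integrable hM hX).const_mul _) (integrable_const _),
      integral_const_mul, integral_const, probReal_univ, one_smul] at hle
    have := le_of_mul_le_mul_left (le_of_add_le_add_right hle) (by positivity)
    exact this
  refine le_antisymm (key X hX) ?_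
  have := key (-X) (M.neg_mem hX)
  simp only [Pi.neg_apply, integral_neg, map_neg] at this
  linarith

end IsDaniell

/-! ### Hahn–Banach and supporting measures -/

/-- A finite convex function on a real vector space that vanishes at the origin has a linear
minorant. -/
theorem exists_linearMap_le_of_convexOn {V : Type*} [AddCommGroup V] [Module ℝ V] {Φ : V → ℝ}
    (hΦ : ConvexOn ℝ Set.univ Φ) (h0 : Φ 0 = 0) : ∃ μ : V →ₗ[ℝ] ℝ, ∀ v, μ v ≤ Φ v := by
  -- The directional derivative of `Φ` at `0`, a sublinear minorant of `Φ`. It is finite since `0`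
  -- is a convex combination of `t • v` and `-v`.
  let p : V → ℝ := fun v => ⨅ t : Set.Ioi (0 : ℝ), Φ ((t : ℝ) • v) / t
  have : Nonempty (Set.Ioi (0 : ℝ)) := ⟨⟨1, Set.mem_Ioi.2 one_pos⟩⟩
  have hlow : ∀ v, ∀ t : ℝ, 0 < t → -Φ (-v) ≤ Φ (t • v) / t := fun v t ht => by
    have h1t : (0 : ℝ) < 1 + t := by linarith
    have h := hΦ.2 (Set.mem_univ (t • v)) (Set.mem_univ (-v))
      (one_div_pos.2 h1t).le (div_pos ht h1t).le (by field_simp)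
    have hz : (1 / (1 + t)) • t • v + (t / (1 + t)) • -v = 0 := by
      rw [smul_smul, smul_neg, one_div_mul_eq_div, add_neg_cancel]
    rw [hz, h0, smul_eq_mul, smul_eq_mul, one_div_mul_eq_div, div_mul_eq_mul_div, ← add_div] at h
    rw [le_div_iff₀ ht]
    have := (le_div_iff₀ h1t).1 h
    linarith
  have hbdd : ∀ v, BddBelow (Set.range fun t : Set.Ioi (0 : ℝ) => Φ ((t : ℝ) • v) / t) := fun v =>
    ⟨-Φ (-v), by rintro _ ⟨t, rfl⟩; exact hlow v t t.2⟩
  have hple : ∀ v, ∀ t : ℝ, 0 < t → p v ≤ Φ (t • v) / t := fun v t ht =>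
    ciInf_le (hbdd v) ⟨t, ht⟩
  have hsmul : ∀ c : ℝ, 0 < c → ∀ v, p (c • v) ≤ c * p v := fun c hc v => by
    rw [← div_le_iff₀' hc]
    refine le_ciInf fun s => ?_
    have hs : (0 : ℝ) < s := s.2
    have := hple (c • v) (s / c) (div_pos hs hc)
    rw [smul_smul, div_mul_cancel₀ _ hc.ne'] at this
    rw [div_le_iff₀ hc]
    refine this.trans (le_of_eq ?_)
    field_simp
  obtain ⟨μ, -, hμ⟩ := exists_extension_of_le_sublinear (⊥ : V →ₗ.[ℝ] ℝ) p
    (fun c hc v => le_antisymm (hsmul c hc v) (by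
      have := hsmul c⁻¹ (inv_pos.2 hc) (c • v)
      rw [smul_smul, inv_mul_cancel₀ hc.ne', one_smul] at this
      rwa [← le_inv_mul_iff₀ hc]))
    (fun v w => by
      rw [← sub_le_iff_le_add]
      refine le_ciInf fun s => ?_
      rw [sub_le_comm]
      refine le_ciInf fun t => ?_
      have hs : (0 : ℝ) < s := s.2
      have ht : (0 : ℝ) < t := t.2
      have hst : (0 : ℝ) < t + s := by linarith
      -- This scale makes `(t * s / (t + s)) • (v + w)` a convex combination of `s • v` and `t • w`.
      have h1 := hple (v + w) (t * s / (t + s)) (by positivity)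
      have h := hΦ.2 (Set.mem_univ ((s : ℝ) • v)) (Set.mem_univ ((t : ℝ) • w))
        (div_pos ht hst).le (div_pos hs hst).le (by field_simp)
      have hz : ((t : ℝ) / (t + s)) • (s : ℝ) • v + ((s : ℝ) / (t + s)) • (t : ℝ) • w =
          ((t : ℝ) * s / (t + s)) • (v + w) := by
        rw [smul_smul, smul_smul, smul_add]
        congr 2 <;> ring
      rw [hz, smul_eq_mul, smul_eq_mul] at h
      rw [sub_le_iff_le_add']
      refine h1.trans ((div_le_div_of_nonneg_right h (by positivity)).trans (le_of_eq ?_))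
      field_simp)
    (by
      rintro ⟨x, hx⟩
      have hx0 : x = 0 := (Submodule.mem_bot ℝ).1 hx
      subst hx0
      have : p 0 = 0 := by simp [p, h0]
      have hf : (⊥ : V →ₗ.[ℝ] ℝ) ⟨0, hx⟩ = 0 := LinearPMap.map_zero _
      exact (hf.trans this.symm).le)
  refine ⟨μ, fun v => (hμ v).trans ?_⟩
  simpa using hple v 1 one_pos

theorem tendsto_integralFunctional {m : MeasurableSpace Ω} (ν : ProbabilityMeasure Ω)
    {Xs : ℕ → Linf m} {X : Linf m} (D : ℝ) (hD : ∀ n ω, |(Xs n : Ω → ℝ) ω| ≤ D)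
    (hX : ∀ ω, Tendsto (fun n => (Xs n : Ω → ℝ) ω) atTop (𝓝 ((X : Ω → ℝ) ω))) :
    Tendsto (fun n => integralFunctional ν (Xs n)) atTop (𝓝 (integralFunctional ν X)) :=
  tendsto_integral_of_dominated_convergence (fun _ => D)
    (fun n => (Xs n).2.1.aestronglyMeasurable) (integrable_const D)
    (fun n => Eventually.of_forall (hD n)) (Eventually.of_forall hX)

theorem integralFunctional_mono {m : MeasurableSpace Ω} (ν : ProbabilityMeasure Ω)
    (X Y : Linf m) (h : ∀ ω, (X : Ω → ℝ) ω ≤ (Y : Ω → ℝ) ω) :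
    integralFunctional ν X ≤ integralFunctional ν Y :=
  integral_mono (integrable_of_mem_Linf ν X.2) (integrable_of_mem_Linf ν Y.2) h

/-- Makes capacitability available for `ν` itself. -/
theorem continuousFromBelow_integralFunctional {m : MeasurableSpace Ω} (ν : ProbabilityMeasure Ω) :
    ContinuousFromBelow fun X : Linf m => integralFunctional ν X := by
  intro Xs X hmono hX
  obtain ⟨-, C, hC⟩ := X.2
  obtain ⟨-, D, hD⟩ := (Xs 0).2
  refine ⟨fun i j hij => integralFunctional_mono ν _ _ fun ω => hmono ω hij,
    tendsto_integralFunctional ν (max C D) (fun n ω => abs_le.2 ⟨?_, ?_⟩) hX⟩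
  · have h1 : (Xs 0 : Ω → ℝ) ω ≤ (Xs n : Ω → ℝ) ω := hmono ω n.zero_le
    linarith [(abs_le.1 (hD ω)).1, le_max_right C D]
  · have h1 : (Xs n : Ω → ℝ) ω ≤ (X : Ω → ℝ) ω := (hmono ω).ge_of_tendsto (hX ω) n
    linarith [(abs_le.1 (hC ω)).2, le_max_left C D]

/-- Along a decreasing sequence bounded from below, a convex pre-expectation that is continuous
from above is supported by a countably additive probability measure. -/
theorem exists_supporting_measure {M : Submodule ℝ (Ω → ℝ)} (hL : IsUnitalLattice M)
    (hM : M ≤ Linf (sigmaOf (M : Set (Ω → ℝ)))) {E : M → ℝ} (hE : IsPreExpectation E)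
    (hconv : ConvexOn ℝ Set.univ E) (habove : ContinuousFromAbove E) {Xs : ℕ → M}
    (hanti : ∀ ω, Antitone fun n => (Xs n : Ω → ℝ) ω) {C : ℝ} (hC : ∀ n ω, -C ≤ (Xs n : Ω → ℝ) ω)
    {b : ℝ} (hb : Tendsto (fun n => E (Xs n)) atTop (𝓝 b)) :
    ∃ ν : @ProbabilityMeasure Ω (sigmaOf (M : Set (Ω → ℝ))), ∀ (X : M) (n : ℕ),
      integralFunctional ν (Submodule.inclusion hM X) - E X ≤
        integralFunctional ν (Submodule.inclusion hM (Xs n)) - b := by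
  have hEanti : ∀ Z : M, Antitone fun n => E (Z + Xs n) := fun Z m n hmn =>
    hE.mono _ _ fun ω => add_le_add_right (hanti ω hmn) ((Z : Ω → ℝ) ω)
  have hEbdd : ∀ Z : M, BddBelow (Set.range fun n => E (Z + Xs n)) := fun Z => by
    obtain ⟨-, K, hK⟩ := hM Z.2
    refine ⟨-K + -C, ?_⟩
    rintro _ ⟨n, rfl⟩
    rw [← hE.const (-K + -C) (hL.const_mem _)]
    exact hE.mono _ _ fun ω => add_le_add (abs_le.1 (hK ω)).1 (hC n ω)
  let Φ : M → ℝ := fun Z => (⨅ n, E (Z + Xs n)) - b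
  have hΦlim : ∀ Z, Tendsto (fun n => E (Z + Xs n) - b) atTop (𝓝 (Φ Z)) := fun Z =>
    (tendsto_atTop_ciInf (hEanti Z) (hEbdd Z)).sub_const b
  have hΦ0 : Φ 0 = 0 := by
    refine tendsto_nhds_unique (hΦlim 0) ?_
    simpa using hb.sub_const b
  have hΦconv : ConvexOn ℝ Set.univ Φ := by
    refine ⟨convex_univ, fun Y _ Z _ s t hs ht hst => ?_⟩
    refine le_of_tendsto_of_tendsto' (hΦlim _)
      (((hΦlim Y).const_smul s).add ((hΦlim Z).const_smul t)) fun n => ?_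
    have h := hconv.2 (Set.mem_univ (Y + Xs n)) (Set.mem_univ (Z + Xs n)) hs ht hst
    have hz : s • (Y + Xs n) + t • (Z + Xs n) = s • Y + t • Z + Xs n := by
      have : Xs n = (s + t) • Xs n := by rw [hst, one_smul]
      conv_rhs => rw [this]
      module
    rw [hz] at h
    simp only [smul_eq_mul] at h ⊢
    have hb' : b = s * b + t * b := by rw [← add_mul, hst, one_mul]
    linarith
  obtain ⟨μ, hμ⟩ := exists_linearMap_le_of_convexOn hΦconv hΦ0
  have hkey : ∀ Z n, μ Z ≤ E (Z + Xs n) - b := fun Z n =>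
    (hμ Z).trans (sub_le_sub_right (ciInf_le (hEbdd Z) n) b)
  -- The extension to all functions is arbitrary; only its values on `M` matter.
  obtain ⟨φ, hφ⟩ := μ.exists_extend
  have hφμ : ∀ Z : M, φ Z = μ Z := fun Z => LinearMap.congr_fun hφ Z
  have hD : IsDaniell M φ := by
    have hnonneg : ∀ X ∈ M, (∀ ω, 0 ≤ X ω) → 0 ≤ φ X := fun X hX h0 => by
      have h1 : μ (-⟨X, hX⟩) ≤ 0 := by
        refine ge_of_tendsto' (by simpa using hb.sub_const b) fun n =>
          (hkey _ n).trans (sub_le_sub_right (hE.mono _ _ fun ω => ?_) b)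
        show -X ω + (Xs n : Ω → ℝ) ω ≤ (Xs n : Ω → ℝ) ω
        linarith [h0 ω]
      rw [map_neg, ← hφμ] at h1
      exact neg_nonpos.1 h1
    refine ⟨hL, hnonneg, ?_, fun Z hZM hZ hZ0 => ?_⟩
    · obtain ⟨-, K, hK⟩ := hM (Xs 0).2
      have h1 : ∀ t : ℝ, t * φ (fun _ => 1) ≤ t + (K - b) := fun t => by
        have h2 := hkey (t • ⟨_, hL.one_mem⟩) 0
        rw [map_smul, ← hφμ, smul_eq_mul] at h2
        have h3 : E (t • ⟨_, hL.one_mem⟩ + Xs 0) ≤ t + K := by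
          rw [← hE.const (t + K) (hL.const_mem _)]
          refine hE.mono _ _ fun ω => ?_
          show t * 1 + (Xs 0 : Ω → ℝ) ω ≤ t + K
          linarith [(abs_le.1 (hK ω)).2]
        linarith
      by_contra hne
      have hne' := sub_ne_zero.2 hne
      -- An affine bound for all real `t` forces slope `1`; this `t` would give `K - b + 1 ≤ K - b`.
      have h2 := h1 ((K - b + 1) / (φ (fun _ => 1) - 1))
      have h3 : (K - b + 1) / (φ (fun _ => 1) - 1) * (φ (fun _ => 1) - 1) = K - b + 1 :=
        div_mul_cancel₀ _ hne'
      linarith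
    · refine tendsto_order.2 ⟨fun a ha => Eventually.of_forall fun n => ha.trans_le
        (hnonneg _ (hZM n) fun ω => (hZ ω).le_of_tendsto (hZ0 ω) n), fun ε hε => ?_⟩
      -- Once `E (Xs k) < b + ε`, continuity from above gives `E (Z n + Xs k) < b + ε` for large
      -- `n`, hence `φ (Z n) < ε`.
      obtain ⟨k, hk⟩ := (hb.eventually (gt_mem_nhds (lt_add_of_pos_right b hε))).exists
      have hlim := (habove (fun n => ⟨Z n, hZM n⟩ + Xs k) (Xs k)
        (fun ω i j hij => add_le_add_left (hZ ω hij) _)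
        (fun ω => by simpa using (hZ0 ω).add_const ((Xs k : Ω → ℝ) ω))).2
      filter_upwards [hlim.eventually (gt_mem_nhds hk)] with n hn
      have := hkey ⟨Z n, hZM n⟩ k
      rw [← hφμ] at this
      linarith
  refine ⟨⟨hD.measure, hD.isProbabilityMeasure_measure⟩, fun X n => ?_⟩
  have hint : ∀ Z : M, integralFunctional ⟨hD.measure, hD.isProbabilityMeasure_measure⟩
      (Submodule.inclusion hM Z) = μ Z := fun Z => (hD.integral_eq hM Z.2).trans (hφμ Z)
  rw [hint, hint]
  have := hkey (X - Xs n) n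
  rw [map_sub, sub_add_cancel] at this
  linarith

/-! ### Comparison of the conjugates -/

theorem conjugate_comp_inclusion_le {M L : Submodule ℝ (Ω → ℝ)} (hM : M ≤ L) {Et : L → ℝ}
    {E : M → ℝ} (hext : ∀ X : M, Et (Submodule.inclusion hM X) = E X) (μ : L →ₗ[ℝ] ℝ) :
    conjugate E (μ.comp (Submodule.inclusion hM)) ≤ conjugate Et μ := by
  refine iSup_le fun X => ?_
  rw [← hext]
  exact le_iSup (fun X : L => ((μ X - Et X : ℝ) : EReal)) (Submodule.inclusion hM X)

theorem conjugate_le_of_bar_le {M : Submodule ℝ (Ω → ℝ)} (hL : IsUnitalLattice M)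
    (hM : M ≤ Linf (sigmaOf (M : Set (Ω → ℝ))))
    {Et : Linf (sigmaOf (M : Set (Ω → ℝ))) → ℝ} {E : M → ℝ}
    (hbar : ∀ X : Linf (sigmaOf (M : Set (Ω → ℝ))), bar E X ≤ (Et X : EReal))
    (ν : @ProbabilityMeasure Ω (sigmaOf (M : Set (Ω → ℝ)))) :
    conjugate Et (integralFunctional ν) ≤
      conjugate E ((integralFunctional ν).comp (Submodule.inclusion hM)) := by
  refine iSup_le fun X => EReal.ge_of_forall_gt_iff_ge.1 fun z hz => ?_
  have hz := EReal.coe_lt_coe_iff.1 hz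
  -- The slack is split in two: one `δ` for approximating `ν X` from below, one for the infimum of
  -- `E (Xs n)`.
  obtain ⟨δ, hδ, hδz⟩ : ∃ δ > 0, z = integralFunctional ν X - δ - (Et X + δ) :=
    ⟨(integralFunctional ν X - Et X - z) / 2, by linarith, by ring⟩
  obtain ⟨Xs, hanti, hle, hlt⟩ := exists_antitone_of_lt hL hM
    (E := fun X => integralFunctional ν X) (integralFunctional_mono ν)
    (continuousFromBelow_integralFunctional ν) X (sub_lt_self _ hδ)
  have h0 : ⨅ n, (E (Xs n) : EReal) ≤ bar E X := by
    refine le_sSup ⟨Xs, fun n ω => hanti ω n.le_succ, fun ω => ?_, rfl⟩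
    exact EReal.ge_of_forall_gt_iff_ge.1 fun r hr => EReal.coe_le_coe_iff.2 (hle ω r fun n =>
      EReal.coe_le_coe_iff.1 (hr.le.trans (iInf_le _ n)))
  have h1 : ⨅ n, (E (Xs n) : EReal) < ((Et X + δ : ℝ) : EReal) :=
    (h0.trans (hbar X)).trans_lt (EReal.coe_lt_coe_iff.2 (lt_add_of_pos_right _ hδ))
  obtain ⟨n, hn⟩ := iInf_lt_iff.1 h1
  refine le_trans (b := (((integralFunctional ν).comp (Submodule.inclusion hM) (Xs n) - E (Xs n) :
    ℝ) : EReal)) (EReal.coe_le_coe_iff.2 ?_)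
    (le_iSup (fun X : M => (((integralFunctional ν).comp (Submodule.inclusion hM) X - E X : ℝ) :
      EReal)) (Xs n))
  have h2 := EReal.coe_lt_coe_iff.1 hn
  have h3 := hlt n
  simp only [LinearMap.comp_apply]
  linarith

theorem bar_le_of_conjugate_le {M : Submodule ℝ (Ω → ℝ)} (hL : IsUnitalLattice M)
    (hM : M ≤ Linf (sigmaOf (M : Set (Ω → ℝ)))) {E : M → ℝ} (hE : IsPreExpectation E)
    (hconv : ConvexOn ℝ Set.univ E) (habove : ContinuousFromAbove E)
    {Et : Linf (sigmaOf (M : Set (Ω → ℝ))) → ℝ} (hEt : IsPreExpectation Et)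
    (hconj : ∀ ν : @ProbabilityMeasure Ω (sigmaOf (M : Set (Ω → ℝ))),
      conjugate Et (integralFunctional ν) ≤
        conjugate E ((integralFunctional ν).comp (Submodule.inclusion hM)))
    (X : Linf (sigmaOf (M : Set (Ω → ℝ)))) : bar E X ≤ (Et X : EReal) := by
  refine sSup_le ?_
  rintro _ ⟨Xs, hanti, hle, rfl⟩
  obtain ⟨-, C, hC⟩ := X.2
  -- Truncation at `-C` makes `b` finite, can only raise `E`, and keeps the infimum below `X`
  -- because `X ≥ -C`.
  let Ys : ℕ → M := fun n => ⟨_, hL.max_mem (Xs n).2 (hL.const_mem (-C))⟩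
  have hYanti : ∀ ω, Antitone fun n => (Ys n : Ω → ℝ) ω := fun ω =>
    antitone_nat_of_succ_le fun n => max_le_max (hanti n ω) le_rfl
  have hYC : ∀ n ω, -C ≤ (Ys n : Ω → ℝ) ω := fun n ω => le_max_right _ _
  obtain ⟨-, D, hD⟩ := hM (Ys 0).2
  have hYbdd : ∀ n ω, |(Ys n : Ω → ℝ) ω| ≤ max C D := fun n ω => by
    have h1 : (Ys n : Ω → ℝ) ω ≤ (Ys 0 : Ω → ℝ) ω := hYanti ω n.zero_le
    exact abs_le.2 ⟨by linarith [hYC n ω, le_max_left C D],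
      by linarith [(abs_le.1 (hD ω)).2, le_max_right C D]⟩
  have hbelow : ∀ ω, BddBelow (Set.range fun n => (Ys n : Ω → ℝ) ω) := fun ω =>
    ⟨-C, by rintro _ ⟨n, rfl⟩; exact hYC n ω⟩
  let Y : Linf (sigmaOf (M : Set (Ω → ℝ))) := ⟨fun ω => ⨅ n, (Ys n : Ω → ℝ) ω,
    Measurable.iInf fun n => (hM (Ys n).2).1, max C D, fun ω => abs_le.2
      ⟨le_ciInf fun n => (abs_le.1 (hYbdd n ω)).1,
        (ciInf_le (hbelow ω) 0).trans (abs_le.1 (hYbdd 0 ω)).2⟩⟩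
  have hYX : ∀ ω, (Y : Ω → ℝ) ω ≤ (X : Ω → ℝ) ω := fun ω => by
    by_contra! hlt
    have h1 : ∀ n, (Y : Ω → ℝ) ω ≤ (Xs n : Ω → ℝ) ω := fun n =>
      (le_max_iff.1 (ciInf_le (hbelow ω) n)).resolve_right
        ((abs_le.1 (hC ω)).1.trans_lt hlt).not_ge
    have h2 : (((Y : Ω → ℝ) ω : ℝ) : EReal) ≤ (((X : Ω → ℝ) ω : ℝ) : EReal) :=
      (le_iInf fun n => EReal.coe_le_coe_iff.2 (h1 n)).trans (hle ω)
    exact hlt.not_ge (EReal.coe_le_coe_iff.1 h2)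
  have hEanti : Antitone fun n => E (Ys n) := fun m n hmn =>
    hE.mono _ _ fun ω => hYanti ω hmn
  have hb := tendsto_atTop_ciInf hEanti ⟨-C, by
    rintro _ ⟨n, rfl⟩
    rw [← hE.const (-C) (hL.const_mem _)]
    exact hE.mono _ _ (hYC n)⟩
  set b := ⨅ n, E (Ys n)
  obtain ⟨ν, hν⟩ := exists_supporting_measure hL hM hE hconv habove hYanti hYC hb
  have hlim := tendsto_integralFunctional ν (Xs := fun n => Submodule.inclusion hM (Ys n)) (X := Y)
    (max C D) hYbdd fun ω => tendsto_atTop_ciInf (hYanti ω) (hbelow ω)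
  have h1 : conjugate E ((integralFunctional ν).comp (Submodule.inclusion hM)) ≤
      ((integralFunctional ν Y - b : ℝ) : EReal) :=
    iSup_le fun Z => EReal.coe_le_coe_iff.2
      (ge_of_tendsto' (hlim.sub_const b) fun n => hν Z n)
  have h2 : ((integralFunctional ν Y - Et Y : ℝ) : EReal) ≤ conjugate Et (integralFunctional ν) :=
    le_iSup (fun Z => ((integralFunctional ν Z - Et Z : ℝ) : EReal)) Y
  have h3 := EReal.coe_le_coe_iff.1 (h2.trans ((hconj ν).trans h1))
  have h4 := hEt.mono Y X hYX
  refine le_trans (b := (b : EReal)) ?_ (EReal.coe_le_coe_iff.2 (by linarith))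
  refine ge_of_tendsto' ((continuous_coe_real_ereal.tendsto b).comp hb) fun n => ?_
  exact (iInf_le _ n).trans (EReal.coe_le_coe_iff.2 (hE.mono _ _ fun ω => le_max_left _ _))

end NonlinearExpectation

theorem mainTheorem6 {Ω : Type*} (𝓕 : MeasurableSpace Ω)
    (M : Submodule ℝ (Ω → ℝ)) (hM : M ≤ NonlinearExpectation.Linf 𝓕)
    (hone : (fun _ : Ω => (1 : ℝ)) ∈ M)
    (hriesz : ∀ X ∈ M, ∀ Y ∈ M, (fun ω => min (X ω) (Y ω)) ∈ M)
    (E : M → ℝ) (hE : NonlinearExpectation.IsPreExpectation E)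
    (hconv : ConvexOn ℝ Set.univ E)
    (habove : NonlinearExpectation.ContinuousFromAbove E)
    (Et : NonlinearExpectation.Linf (NonlinearExpectation.sigmaOf (M : Set (Ω → ℝ))) → ℝ)
    (hEt : NonlinearExpectation.IsPreExpectation Et)
    (hbelow : NonlinearExpectation.ContinuousFromBelow Et)
    (hext : ∀ X : M,
      Et (Submodule.inclusion (NonlinearExpectation.le_Linf_sigmaOf hM) X) = E X) :
    (∀ X, (Et X : EReal) ≤ NonlinearExpectation.bar E X) ∧
    ((∀ X, (Et X : EReal) = NonlinearExpectation.bar E X) ↔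
      ∀ ν : @MeasureTheory.ProbabilityMeasure Ω
          (NonlinearExpectation.sigmaOf (M : Set (Ω → ℝ))),
        NonlinearExpectation.conjugate Et (NonlinearExpectation.integralFunctional ν) =
          NonlinearExpectation.conjugate E
            ((NonlinearExpectation.integralFunctional ν).comp
              (Submodule.inclusion (NonlinearExpectation.le_Linf_sigmaOf hM)))) := by
  have hL : NonlinearExpectation.IsUnitalLattice M := ⟨hone, hriesz⟩
  have hML := NonlinearExpectation.le_Linf_sigmaOf hM
  have hle := NonlinearExpectation.le_bar hL hML hEt.mono hbelow hext
  refine ⟨hle, fun h ν => ?_, fun h X => ?_⟩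
  · exact le_antisymm
      (NonlinearExpectation.conjugate_le_of_bar_le hL hML (fun X => (h X).ge) ν)
      (NonlinearExpectation.conjugate_comp_inclusion_le hML hext _)
  · exact le_antisymm (hle X) (NonlinearExpectation.bar_le_of_conjugate_le hL hML hE hconv habove
      hEt (fun ν => (h ν).le) X)
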